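/- A \emph{disk} is a set $\{z\in\mathbb R^2 : \|z-c\|\le r\}$ with $c\in\mathbb R^2$ and $r\in\mathbb R$. A set $\mathcal D$ of disks \emph{identifies} a set $\mathcal P\subseteq\mathbb R^2$ if every point of $\mathcal P$ belongs to at least one disk of $\mathcal D$ and, for any two distinct points of $\mathcal P$, some disk of $\mathcal D$ contains exactly one of them. Let $\gamma^{\mathrm{ID}}_D(\mathcal P)$ be the minimum number of disks in a set of disks that identifies $\mathcal P$, and let $\mathcal P_{2,n}=\{(x,y)\in\mathbb Z^2 : 1\le x\le n,\ 1\le y\le 2\}$ be the $2\times n$ grid. \textbf{Theorem (grids of height 2).} Let $n\ge 2$ be an integer. Then $$\gamma^{\mathrm{ID}}_D(\mathcal P_{2,n})=\begin{cases}\left\lceil \frac{n+1}{2}\right\rceil+1 & \text{if } n\in\{2,3,4,5,7\},\\[2pt] \left\lceil \frac{n+1}{2}\right\rceil & \text{otherwise.}\end{cases}$$ -/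

import Mathlib

/-- The Euclidean plane. -/
abbrev Plane : Type := EuclideanSpace ℝ (Fin 2)

/-- A disk: the set of points at distance at most `r` of a center `c`. -/
def IsDisk (D : Set Plane) : Prop :=
  ∃ (c : Plane) (r : ℝ), D = Metric.closedBall c r

/-- `D` separates `P` and `Q` if exactly one of the two points belongs to `D`. -/
def Separates (D : Set Plane) (P Q : Plane) : Prop :=
  (P ∈ D ∧ Q ∉ D) ∨ (P ∉ D ∧ Q ∈ D)

/-- A set of disks identifies `S` if it covers every point of `S` and separates every pair of
distinct points of `S`. -/
def IsIdentifying (𝒟 : Set (Set Plane)) (S : Set Plane) : Prop :=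
  (∀ D ∈ 𝒟, IsDisk D) ∧
  (∀ P ∈ S, ∃ D ∈ 𝒟, P ∈ D) ∧
  (∀ P ∈ S, ∀ Q ∈ S, P ≠ Q → ∃ D ∈ 𝒟, Separates D P Q)

/-- The minimum number of disks needed to identify `S`, as an extended natural number. -/
noncomputable def diskIdNumber (S : Set Plane) : ℕ∞ :=
  ⨅ (𝒟 : Set (Set Plane)) (_ : IsIdentifying 𝒟 S), 𝒟.encard

/-- The grid of height `m` and width `n`: the points `(x, y)` of `ℤ²` with `1 ≤ y ≤ m` and
`1 ≤ x ≤ n`. -/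
def grid (m n : ℕ) : Set Plane :=
  {p | ∃ x y : ℤ, 1 ≤ y ∧ y ≤ m ∧ 1 ≤ x ∧ x ≤ n ∧ p = !₂[(x : ℝ), (y : ℝ)]}

/-! A disk meets each row in an interval of columns, and both intervals are centred at the abscissa
of its centre. Conversely, by `exists_isDisk_of_intervals`, two nonempty intervals whose midpoints
differ by at most 1/2 come from one disk. The problem is thus about pairs of intervals.

Lower bound: covering the ends of a row and separating neighbours forces each of its n + 1 edges,
outer ones included, to be crossed by some disk. A disk crosses a row at most twice, so k disks need
n + 1 ≤ 2k. For n = 2, 3, 4, 5 a count of codes (the code of a point is the set of disks containing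
it) is stronger: the 2n codes are distinct and nonempty, so 2n + 1 ≤ 2 ^ k. For n = 7, four disks
would cross every edge of each row exactly once, which a finite check excludes.

Upper bound: explicit interval families for n = 3, n = 6 and every odd n ≥ 9; the other widths
follow by monotonicity. -/

/-- The lattice point with coordinates `(x, y)`. -/
noncomputable def latticePoint (x y : ℤ) : Plane := !₂[(x : ℝ), (y : ℝ)]

theorem dist_sq_latticePoint (x y : ℤ) (c : Plane) :
    dist (latticePoint x y) c ^ 2 = ((x : ℝ) - c 0) ^ 2 + ((y : ℝ) - c 1) ^ 2 := by
  rw [EuclideanSpace.dist_eq, Real.sq_sqrt (by positivity)]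
  simp [latticePoint, Real.dist_eq, sq_abs]

theorem latticePoint_injective {x y x' y' : ℤ} (h : latticePoint x y = latticePoint x' y') :
    x = x' ∧ y = y' := by
  have h0 := congrArg (fun p : Plane => p 0) h
  have h1 := congrArg (fun p : Plane => p 1) h
  simp [latticePoint] at h0 h1
  exact ⟨h0, h1⟩

theorem latticePoint_mem_grid {m n : ℕ} {x y : ℤ} (hy : 1 ≤ y) (hy' : y ≤ m) (hx : 1 ≤ x)
    (hx' : x ≤ n) : latticePoint x y ∈ grid m n :=
  ⟨x, y, hy, hy', hx, hx', rfl⟩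

theorem mem_grid_two {n : ℕ} {p : Plane} (hp : p ∈ grid 2 n) :
    ∃ x : ℤ, 1 ≤ x ∧ x ≤ n ∧ (p = latticePoint x 1 ∨ p = latticePoint x 2) := by
  obtain ⟨x, y, h1, h2, h3, h4, rfl⟩ := hp
  refine ⟨x, h3, h4, ?_⟩
  have : y = 1 ∨ y = 2 := by
    push_cast at h2
    omega
  rcases this with rfl | rfl
  · exact Or.inl rfl
  · exact Or.inr rfl

/-! ### Disks as pairs of intervals -/

/-- On each horizontal line, a disk meets an interval whose midpoint does not depend on the line. -/
theorem IsDisk.exists_center {D : Set Plane} (hD : IsDisk D) :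
    ∃ s : ℝ, ∀ y a b : ℤ, latticePoint a y ∈ D → latticePoint b y ∉ D →
      (a < b → s < a + b) ∧ (b < a → (a : ℝ) + b < s) := by
  obtain ⟨c, r, rfl⟩ := hD
  refine ⟨2 * c 0, fun y a b ha hb => ?_⟩
  rw [Metric.mem_closedBall] at ha hb
  have h : dist (latticePoint a y) c ^ 2 < dist (latticePoint b y) c ^ 2 :=
    pow_lt_pow_left₀ (by linarith) dist_nonneg two_ne_zero
  rw [dist_sq_latticePoint, dist_sq_latticePoint] at h
  constructor
  · intro hab
    have hab' : (a : ℝ) < b := by exact_mod_cast hab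
    nlinarith
  · intro hab
    have hab' : (b : ℝ) < a := by exact_mod_cast hab
    nlinarith

/-- Two intervals on consecutive lines, with midpoints at distance at most `1/2`, are cut out by
a disk. -/
theorem exists_isDisk_of_intervals {l₁ r₁ l₂ r₂ : ℤ} (h₁ : l₁ < r₁) (h₂ : l₂ < r₂)
    (h : l₁ + r₁ ≤ l₂ + r₂ + 1) (h' : l₂ + r₂ ≤ l₁ + r₁ + 1) :
    ∃ D, IsDisk D ∧ (∀ x, latticePoint x 1 ∈ D ↔ l₁ < x ∧ x ≤ r₁) ∧
      (∀ x, latticePoint x 2 ∈ D ↔ l₂ < x ∧ x ≤ r₂) := by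
  -- The interval centred at (l + r + 1) / 2 with half-length (r - l) / 2 ends at half-integers, so
  -- shifting it by t / 4 with |t| ≤ 1 changes none of its integer points.
  have key : ∀ (l r t x : ℤ), l < r → -1 ≤ t → t ≤ 1 →
      (((x : ℝ) - (2 * (l + r) + t + 2) / 4) ^ 2 ≤ (((r : ℝ) - l) / 2) ^ 2 ↔ l < x ∧ x ≤ r) := by
    intro l r t x hlr ht ht'
    have hlr' : (l : ℝ) < r := by exact_mod_cast hlr
    rw [sq_le_sq, abs_of_nonneg (a := ((r : ℝ) - l) / 2) (by linarith), abs_le]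
    have e1 : (-(((r : ℝ) - l) / 2) ≤ (x : ℝ) - (2 * (l + r) + t + 2) / 4) ↔
        4 * l + t + 2 ≤ 4 * x := by
      rw [← Int.cast_le (R := ℝ)]
      push_cast
      constructor <;> intro h <;> linarith
    have e2 : ((x : ℝ) - (2 * (l + r) + t + 2) / 4 ≤ ((r : ℝ) - l) / 2) ↔
        4 * x ≤ 4 * r + t + 2 := by
      rw [← Int.cast_le (R := ℝ)]
      push_cast
      constructor <;> intro h <;> linarith
    rw [e1, e2]
    omega
  set a : ℝ := ((r₁ : ℝ) - l₁) / 2 with ha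
  set b : ℝ := ((r₂ : ℝ) - l₂) / 2 with hb
  -- `u` is the mean of the two midpoints; `v` is the height for which the chords on the lines y = 1
  -- and y = 2 have half-lengths `a` and `b`.
  set u : ℝ := ((l₁ : ℝ) + r₁ + l₂ + r₂ + 2) / 4 with hu
  set v : ℝ := (3 - a ^ 2 + b ^ 2) / 2 with hv
  have hmem : ∀ x y : ℤ, latticePoint x y ∈
      Metric.closedBall (!₂[u, v] : Plane) (√(a ^ 2 + (1 - v) ^ 2)) ↔
      ((x : ℝ) - u) ^ 2 + ((y : ℝ) - v) ^ 2 ≤ a ^ 2 + (1 - v) ^ 2 := by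
    intro x y
    rw [Metric.mem_closedBall, Real.le_sqrt dist_nonneg, dist_sq_latticePoint]
    · simp
    · positivity
  refine ⟨Metric.closedBall !₂[u, v] (√(a ^ 2 + (1 - v) ^ 2)), ⟨_, _, rfl⟩, fun x => ?_, fun x => ?_⟩
  · rw [hmem, ← key l₁ r₁ (l₂ + r₂ - l₁ - r₁) x h₁ (by omega) (by omega)]
    have : u = (2 * ((l₁ : ℝ) + r₁) + ((l₂ + r₂ - l₁ - r₁ : ℤ) : ℝ) + 2) / 4 := by
      rw [hu]; push_cast; ring
    rw [← this, ← ha]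
    push_cast
    constructor <;> intro h <;> linarith
  · rw [hmem, ← key l₂ r₂ (l₁ + r₁ - l₂ - r₂) x h₂ (by omega) (by omega)]
    have : u = (2 * ((l₂ : ℝ) + r₂) + ((l₁ + r₁ - l₂ - r₂ : ℤ) : ℝ) + 2) / 4 := by
      rw [hu]; push_cast; ring
    rw [← this, ← hb]
    push_cast
    have : (2 - v) ^ 2 - (1 - v) ^ 2 = a ^ 2 - b ^ 2 := by rw [hv]; ring
    constructor <;> intro h <;> linarith

/-! ### Upper bounds: explicit families -/

theorem diskIdNumber_mono {S T : Set Plane} (h : S ⊆ T) : diskIdNumber S ≤ diskIdNumber T :=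
  le_iInf₂ fun 𝒟 h𝒟 => iInf₂_le 𝒟
    ⟨h𝒟.1, fun P hP => h𝒟.2.1 P (h hP), fun P hP Q hQ => h𝒟.2.2 P (h hP) Q (h hQ)⟩

theorem grid_mono (m : ℕ) {n n' : ℕ} (h : n ≤ n') : grid m n ⊆ grid m n' := by
  rintro p ⟨x, y, h1, h2, h3, h4, rfl⟩
  exact ⟨x, y, h1, h2, h3, by omega, rfl⟩

/-- Pairs of intervals with close midpoints that identify the two rows combinatorially give an
identifying set of disks. -/
theorem diskIdNumber_grid_two_le {n : ℕ} {ι : Type*} [Fintype ι] (l₁ r₁ l₂ r₂ : ι → ℤ)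
    (h₁ : ∀ i, l₁ i < r₁ i) (h₂ : ∀ i, l₂ i < r₂ i)
    (h : ∀ i, l₁ i + r₁ i ≤ l₂ i + r₂ i + 1) (h' : ∀ i, l₂ i + r₂ i ≤ l₁ i + r₁ i + 1)
    (cov₁ : ∀ x : ℤ, 1 ≤ x → x ≤ n → ∃ i, l₁ i < x ∧ x ≤ r₁ i)
    (cov₂ : ∀ x : ℤ, 1 ≤ x → x ≤ n → ∃ i, l₂ i < x ∧ x ≤ r₂ i)
    (sep₁ : ∀ x x' : ℤ, 1 ≤ x → x < x' → x' ≤ n →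
      ∃ i, ¬((l₁ i < x ∧ x ≤ r₁ i) ↔ (l₁ i < x' ∧ x' ≤ r₁ i)))
    (sep₂ : ∀ x x' : ℤ, 1 ≤ x → x < x' → x' ≤ n →
      ∃ i, ¬((l₂ i < x ∧ x ≤ r₂ i) ↔ (l₂ i < x' ∧ x' ≤ r₂ i)))
    (sep : ∀ x x' : ℤ, 1 ≤ x → x ≤ n → 1 ≤ x' → x' ≤ n →
      ∃ i, ¬((l₁ i < x ∧ x ≤ r₁ i) ↔ (l₂ i < x' ∧ x' ≤ r₂ i))) :
    diskIdNumber (grid 2 n) ≤ Fintype.card ι := by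
  choose D hD hD₁ hD₂ using fun i => exists_isDisk_of_intervals (h₁ i) (h₂ i) (h i) (h' i)
  have hsep : ∀ P Q : Plane, (∃ i, ¬(P ∈ D i ↔ Q ∈ D i)) →
      ∃ E ∈ Set.range D, Separates E P Q := by
    rintro P Q ⟨i, hi⟩
    refine ⟨D i, ⟨i, rfl⟩, ?_⟩
    unfold Separates
    tauto
  have hsymm : ∀ P Q : Plane, (∃ i, ¬(P ∈ D i ↔ Q ∈ D i)) → ∃ i, ¬(Q ∈ D i ↔ P ∈ D i) := by
    rintro P Q ⟨i, hi⟩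
    exact ⟨i, fun h => hi h.symm⟩
  have hid : IsIdentifying (Set.range D) (grid 2 n) := by
    refine ⟨?_, ?_, ?_⟩
    · rintro _ ⟨i, rfl⟩
      exact hD i
    · intro P hP
      obtain ⟨x, hx, hx', rfl | rfl⟩ := mem_grid_two hP
      · obtain ⟨i, hi⟩ := cov₁ x hx hx'
        exact ⟨D i, ⟨i, rfl⟩, (hD₁ i x).2 hi⟩
      · obtain ⟨i, hi⟩ := cov₂ x hx hx'
        exact ⟨D i, ⟨i, rfl⟩, (hD₂ i x).2 hi⟩
    · intro P hP Q hQ hPQ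
      apply hsep
      obtain ⟨x, hx, hx', rfl | rfl⟩ := mem_grid_two hP <;>
      obtain ⟨z, hz, hz', rfl | rfl⟩ := mem_grid_two hQ
      · have hne : x ≠ z := by rintro rfl; exact hPQ rfl
        rcases lt_or_gt_of_ne hne with hlt | hlt
        · simpa only [hD₁] using sep₁ x z hx hlt hz'
        · apply hsymm
          simpa only [hD₁] using sep₁ z x hz hlt hx'
      · simpa only [hD₁, hD₂] using sep x z hx hx' hz hz'
      · apply hsymm
        simpa only [hD₁, hD₂] using sep z x hz hz' hx hx'
      · have hne : x ≠ z := by rintro rfl; exact hPQ rfl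
        rcases lt_or_gt_of_ne hne with hlt | hlt
        · simpa only [hD₂] using sep₂ x z hx hlt hz'
        · apply hsymm
          simpa only [hD₂] using sep₂ z x hz hlt hx'
  refine (iInf₂_le (f := fun (𝒟 : Set (Set Plane)) (_ : IsIdentifying 𝒟 (grid 2 n)) => 𝒟.encard)
    _ hid).trans ?_
  rw [← Set.image_univ]
  refine (Set.encard_image_le _ _).trans ?_
  simp

theorem diskIdNumber_grid_two_three_le : diskIdNumber (grid 2 3) ≤ 3 := by
  have h := diskIdNumber_grid_two_le (n := 3) (ι := Fin 3) ![-1, 1, -1] ![4, 4, 2] ![1, 2, -1]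
    ![2, 3, 1] (by decide) (by decide) (by decide) (by decide) ?_ ?_ ?_ ?_ ?_
  · simpa using h
  · intro x h1 h2
    push_cast at h2
    interval_cases x <;> decide
  · intro x h1 h2
    push_cast at h2
    interval_cases x <;> decide
  · intro x x' h1 h2 h3
    push_cast at h3
    have h4 : x ≤ 3 := by omega
    interval_cases x <;> interval_cases x' <;> decide
  · intro x x' h1 h2 h3
    push_cast at h3
    have h4 : x ≤ 3 := by omega
    interval_cases x <;> interval_cases x' <;> decide
  · intro x x' h1 h2 h3 h4
    push_cast at h2 h4
    interval_cases x <;> interval_cases x' <;> decide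

theorem diskIdNumber_grid_two_six_le : diskIdNumber (grid 2 6) ≤ 4 := by
  have h := diskIdNumber_grid_two_le (n := 6) (ι := Fin 4) ![3, 0, 2, 1] ![5, 4, 3, 6] ![1, 1, 0, 2]
    ![6, 3, 5, 4] (by decide) (by decide) (by decide) (by decide) ?_ ?_ ?_ ?_ ?_
  · simpa using h
  · intro x h1 h2
    push_cast at h2
    interval_cases x <;> decide
  · intro x h1 h2
    push_cast at h2
    interval_cases x <;> decide
  · intro x x' h1 h2 h3
    push_cast at h3
    have h4 : x ≤ 6 := by omega
    interval_cases x <;> interval_cases x' <;> decide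
  · intro x x' h1 h2 h3
    push_cast at h3
    have h4 : x ≤ 6 := by omega
    interval_cases x <;> interval_cases x' <;> decide
  · intro x x' h1 h2 h3 h4
    push_cast at h2 h4
    interval_cases x <;> interval_cases x' <;> decide

set_option maxHeartbeats 1000000 in
/-- The disks of a `2 × 9` grid, stretched in the middle to make room for `m` overlapping disks that
contain at most three columns each. -/
theorem diskIdNumber_grid_two_odd_le (m : ℕ) :
    diskIdNumber (grid 2 (2 * m + 9)) ≤ (m + 5 : ℕ) := by
  -- The middle disk of index 0 starts at 4 instead of 3, because the cut at 3 is already made by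
  -- another disk in each row.
  let e : ℕ → ℤ := fun j => max 4 (2 * j + 3)
  have hE' : ∀ x x' : ℤ, (∀ j : Fin m, max 4 (2 * (j : ℤ) + 3) < x ∧ x ≤ 2 * (j : ℤ) + 6 ↔
        max 4 (2 * (j : ℤ) + 3) < x' ∧ x' ≤ 2 * (j : ℤ) + 6) → ∀ j : ℤ, 0 ≤ j → j < m →
      (4 < x ∧ 2 * j + 3 < x ∧ x ≤ 2 * j + 6 ↔ 4 < x' ∧ 2 * j + 3 < x' ∧ x' ≤ 2 * j + 6) := by
    intro x x' h j hj hjm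
    have := h ⟨j.toNat, by omega⟩
    simp only [Int.toNat_of_nonneg hj] at this
    omega
  -- The ends `9 + 4 * m` and `12 + 4 * m` lie at or beyond the last column; their exact values only
  -- bring the two midpoints together.
  have h := diskIdNumber_grid_two_le (n := 2 * m + 9) (ι := Fin 5 ⊕ Fin m)
    (Sum.elim ![0, 1, 2, 3, 6 + 2 * m] fun j => e j)
    (Sum.elim ![e m, 7 + 2 * m, 5 + 2 * m, 9 + 4 * m, 8 + 2 * m] fun j => 2 * j + 6)
    (Sum.elim ![1, 3, 0, 5 + 2 * m, 2] fun j => e j)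
    (Sum.elim ![e m, 6 + 2 * m, 8 + 2 * m, 7 + 2 * m, 12 + 4 * m] fun j => 2 * j + 6)
    ?_ ?_ ?_ ?_ ?_ ?_ ?_ ?_ ?_
  · simpa [add_comm] using h
  · rintro (i | j)
    · fin_cases i <;> simp [e] <;> omega
    · simp [e]; omega
  · rintro (i | j)
    · fin_cases i <;> simp [e] <;> omega
    · simp [e]; omega
  · rintro (i | j)
    · fin_cases i <;> simp [e] <;> omega
    · simp
  · rintro (i | j)
    · fin_cases i <;> simp [e] <;> omega
    · simp
  all_goals simp only [Sum.exists, Fin.exists_fin_succ, Sum.elim_inl, Sum.elim_inr, e]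
  · intro x h1 h2
    simp
    clear hE'
    omega
  · intro x h1 h2
    simp
    clear hE'
    omega
  · intro x x' h1 h2 h3
    by_contra hc
    simp only [not_or, not_exists, not_not] at hc
    obtain ⟨⟨h0, hd1, hd2, hd3, hd4, -⟩, hE⟩ := hc
    replace hE := hE' x x' hE
    clear hE'
    simp at h0 hd1 hd2 hd3 hd4
    -- Index (x - 5) / 2 is that of the first middle disk ending at or after column x; (x' - 4) / 2
    -- that of the last one with 2j + 4 ≤ x'.
    have e0 := hE ((x - 5) / 2)
    have e1 := hE ((x' - 5) / 2)
    have e2 := hE ((x' - 4) / 2)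
    push_cast at *
    clear hE
    omega
  · intro x x' h1 h2 h3
    by_contra hc
    simp only [not_or, not_exists, not_not] at hc
    obtain ⟨⟨h0, hd1, hd2, hd3, hd4, -⟩, hE⟩ := hc
    replace hE := hE' x x' hE
    clear hE'
    simp at h0 hd1 hd2 hd3 hd4
    have e0 := hE ((x - 5) / 2)
    have e1 := hE ((x' - 5) / 2)
    have e2 := hE ((x' - 4) / 2)
    push_cast at *
    clear hE
    omega
  · intro x x' h1 h2 h3 h4
    by_contra hc
    simp only [not_or, not_exists, not_not] at hc
    obtain ⟨⟨h0, hd1, hd2, hd3, hd4, -⟩, hE⟩ := hc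
    replace hE := hE' x x' hE
    clear hE'
    simp at h0 hd1 hd2 hd3 hd4
    -- The middle disks have equal traces on the two rows; the five others suffice to separate
    -- points of different rows.
    push_cast at *
    clear hE
    omega

/-! ### The finite check for seven columns -/

set_option synthInstance.maxHeartbeats 1000000 in
set_option synthInstance.maxSize 4000 in
set_option maxRecDepth 100000 in
/-- In a `2 × 7` grid, four disks would have to cut each row into seven intervals, each cut being
used once; the disks are named after the corner they contain, and two points then always belong to
the same disks. -/
theorem exists_equal_codes_of_seven_columns :
    ∀ bi ∈ List.range' 1 6, ∀ ak ∈ List.range' 1 6, bi ≠ ak →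
    ∀ lj ∈ List.range' 1 6, lj ≠ bi → lj ≠ ak →
    ∀ rj ∈ List.range' 1 6, lj < rj → rj ≠ bi → rj ≠ ak →
    ∀ ll ∈ List.range' 1 6, ll ≠ bi → ll ≠ ak → ll ≠ lj → ll ≠ rj →
    ∀ rl ∈ List.range' 1 6, ll < rl → rl ≠ bi → rl ≠ ak → rl ≠ lj → rl ≠ rj →
    (∀ x ∈ List.range' 1 7, ∀ y ∈ List.range' 1 7, y < x →
      ¬((x ≤ bi ↔ y ≤ bi) ∧ (lj < x ∧ x ≤ rj ↔ lj < y ∧ y ≤ rj) ∧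
        (ak < x ↔ ak < y) ∧ (ll < x ∧ x ≤ rl ↔ ll < y ∧ y ≤ rl))) →
    ∀ bj ∈ List.range' 1 6, lj + rj ≤ bj + 1 → ∀ al ∈ List.range' 1 6, al ≠ bj → al + 6 ≤ ll + rl →
    ∀ li ∈ List.range' 1 6, li ≠ bj → li ≠ al →
    ∀ ri ∈ List.range' 1 6, li < ri → ri ≠ bj → ri ≠ al → li + ri ≤ bi + 1 →
    ∀ lk ∈ List.range' 1 6, lk ≠ bj → lk ≠ al → lk ≠ li → lk ≠ ri →
    ∀ rk ∈ List.range' 1 6, lk < rk → rk ≠ bj → rk ≠ al → rk ≠ li → rk ≠ ri → ak + 6 ≤ lk + rk →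
    ∃ x ∈ List.range' 1 7, ∃ y ∈ List.range' 1 7,
      (((x ≤ bi ↔ li < y ∧ y ≤ ri) ∧ (lj < x ∧ x ≤ rj ↔ y ≤ bj) ∧
        (ak < x ↔ lk < y ∧ y ≤ rk) ∧ (ll < x ∧ x ≤ rl ↔ al < y)) ∨ (x ≠ y ∧
        (li < x ∧ x ≤ ri ↔ li < y ∧ y ≤ ri) ∧ (x ≤ bj ↔ y ≤ bj) ∧
        (lk < x ∧ x ≤ rk ↔ lk < y ∧ y ≤ rk) ∧ (al < x ↔ al < y))) := by
  -- Constraints stand early among the quantifiers, so that failing branches, notably a badly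
  -- separated first row, are dropped before the rest is enumerated.
  decide +kernel

/-! ### Crossings of a single row -/

/-- Each edge of a row, the two outer edges included, is crossed by a disk, and a disk crosses the
row at most twice. -/
theorem exists_injective_crossing {n : ℕ} {ι : Type*} {M : ι → ℕ → Prop}
    (hconv : ∀ i a b c, a < b → b < c → M i a → M i c → M i b)
    (hcross : ∀ t ≤ n, ∃ i, ¬(M i t ↔ M i (t + 1))) :
    ∃ F : Fin (n + 1) → ι × Bool, Function.Injective F ∧
      ∀ t, if (F t).2 then ¬M (F t).1 t ∧ M (F t).1 (t + 1)
        else M (F t).1 t ∧ ¬M (F t).1 (t + 1) := by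
  have hex : ∀ t : Fin (n + 1), ∃ p : ι × Bool, if p.2 then ¬M p.1 t ∧ M p.1 (t + 1)
      else M p.1 t ∧ ¬M p.1 (t + 1) := by
    intro t
    obtain ⟨i, hi⟩ := hcross t (by omega)
    by_cases h : M i t
    · exact ⟨(i, false), by simp; tauto⟩
    · exact ⟨(i, true), by simp; tauto⟩
  choose F hF using hex
  refine ⟨F, ?_, hF⟩
  -- The Boolean is the direction of crossing, `true` for entering. A convex trace is entered at
  -- most once and left at most once.
  have key : ∀ t t' : Fin (n + 1), t < t' → F t ≠ F t' := by
    intro t t' hlt h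
    have hlt' : (t : ℕ) < t' := hlt
    have h1 := hF t
    have h2 := hF t'
    rw [← h] at h2
    cases hb : (F t).2
    · simp only [hb, Bool.false_eq_true, if_false] at h1 h2
      rcases Nat.lt_or_ge (t + 1) t' with h3 | h3
      · exact h1.2 (hconv _ t (t + 1) t' (by omega) h3 h1.1 h2.1)
      · rw [show (t : ℕ) + 1 = t' by omega] at h1
        exact h1.2 h2.1
    · simp only [hb, if_true] at h1 h2
      rcases Nat.lt_or_ge (t + 1) t' with h3 | h3
      · exact h2.1 (hconv _ (t + 1) t' (t' + 1) h3 (by omega) h1.2 h2.2)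
      · rw [show (t : ℕ) + 1 = t' by omega] at h1
        exact h2.1 h1.2
  intro t t' h
  by_contra hne
  rcases lt_or_gt_of_ne hne with hlt | hlt
  · exact key t t' hlt h
  · exact key t' t hlt h.symm

theorem row_crossing_bound {n : ℕ} {ι : Type*} [Fintype ι] {M : ι → ℕ → Prop}
    (hconv : ∀ i a b c, a < b → b < c → M i a → M i c → M i b)
    (hcross : ∀ t ≤ n, ∃ i, ¬(M i t ↔ M i (t + 1))) : n + 1 ≤ 2 * Fintype.card ι := by
  obtain ⟨F, hF, -⟩ := exists_injective_crossing hconv hcross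
  have := Fintype.card_le_of_injective F hF
  simp at this
  omega

/-- If a row has as many edges as crossings available, then every edge is crossed exactly once. -/
theorem exists_intervals_of_tight_row {n : ℕ} {ι : Type*} [Fintype ι] {M : ι → ℕ → Prop}
    (hconv : ∀ i a b c, a < b → b < c → M i a → M i c → M i b)
    (hcross : ∀ t ≤ n, ∃ i, ¬(M i t ↔ M i (t + 1))) (hcard : n + 1 = 2 * Fintype.card ι) :
    ∃ l r : ι → ℕ, (∀ i, l i < r i) ∧ (∀ i, r i ≤ n) ∧ (∀ i j, l i = l j → i = j) ∧
      (∀ i j, r i = r j → i = j) ∧ (∀ i j, l i ≠ r j) ∧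
      ∀ i x, M i x ↔ l i < x ∧ x ≤ r i := by
  obtain ⟨F, hF, hM⟩ := exists_injective_crossing hconv hcross
  -- Equal cardinalities make the injection bijective; its inverse `G` gives the entry edge and the
  -- exit edge of each disk.
  have hbij : Function.Bijective F :=
    (Fintype.bijective_iff_injective_and_card F).2 ⟨hF, by simp; omega⟩
  choose G hG using hbij.2
  have hl : ∀ i, ¬M i (G (i, true)) ∧ M i (G (i, true) + 1) := by
    intro i
    have := hM (G (i, true))
    rw [hG] at this
    simpa using this
  have hr : ∀ i, M i (G (i, false)) ∧ ¬M i (G (i, false) + 1) := by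
    intro i
    have := hM (G (i, false))
    rw [hG] at this
    simpa using this
  have hGinj : ∀ p q, (G p : ℕ) = G q → p = q := by
    intro p q h
    rw [← hG p, ← hG q, Fin.ext h]
  have hlow : ∀ i x, M i x → (G (i, true) : ℕ) < x := by
    intro i x hx
    by_contra hle
    rcases Nat.lt_or_ge x (G (i, true)) with h | h
    · exact (hl i).1 (hconv i x _ _ h (Nat.lt_succ_self _) hx (hl i).2)
    · rw [show x = G (i, true) by omega] at hx
      exact (hl i).1 hx
  have hup : ∀ i x, M i x → x ≤ (G (i, false) : ℕ) := by
    intro i x hx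
    by_contra hle
    rcases Nat.lt_or_ge (G (i, false) + 1) x with h | h
    · exact (hr i).2 (hconv i _ _ x (Nat.lt_succ_self _) h (hr i).1 hx)
    · rw [show x = G (i, false) + 1 by omega] at hx
      exact (hr i).2 hx
  refine ⟨fun i => G (i, true), fun i => G (i, false), fun i => hlow i _ (hr i).1,
    fun i => Nat.le_of_lt_succ (G (i, false)).isLt, fun i j h => by simpa using hGinj _ _ h,
    fun i j h => by simpa using hGinj _ _ h, fun i j h => by simpa using hGinj _ _ h, ?_⟩
  intro i x
  refine ⟨fun h => ⟨hlow i x h, hup i x h⟩, fun ⟨h1, h2⟩ => ?_⟩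
  dsimp only at h1 h2
  rcases Nat.lt_or_ge (G (i, true) + 1) x with h3 | h3
  · rcases Nat.lt_or_ge x (G (i, false)) with h4 | h4
    · exact hconv i _ x _ h3 h4 (hl i).2 (hr i).1
    · rw [show x = G (i, false) by omega]
      exact (hr i).1
  · rw [show x = G (i, true) + 1 by omega]
    exact (hl i).2

/-! ### Traces of an identifying family -/

/-- The trace of a family of disks on row `y` of the grid of width `n`. -/
def rowTrace (n : ℕ) {𝒟 : Set (Set Plane)} (y : ℤ) (D : 𝒟) (x : ℕ) : Prop :=
  1 ≤ x ∧ x ≤ n ∧ latticePoint x y ∈ D.1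

theorem rowTrace_center {n : ℕ} {𝒟 : Set (Set Plane)} (D : 𝒟) (hD : IsDisk D.1) :
    ∃ s : ℝ, ∀ (y : ℤ) (a b : ℕ), rowTrace n y D a → ¬rowTrace n y D b → 1 ≤ b → b ≤ n →
      (a < b → s < a + b) ∧ (b < a → (a : ℝ) + b < s) := by
  obtain ⟨s, hs⟩ := hD.exists_center
  refine ⟨s, fun y a b ha hb hb1 hbn => ?_⟩
  have := hs y a b ha.2.2 (fun h => hb ⟨hb1, hbn, h⟩)
  exact_mod_cast this

theorem rowTrace_convex {n : ℕ} {𝒟 : Set (Set Plane)} (h𝒟 : IsIdentifying 𝒟 (grid 2 n)) (y : ℤ)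
    (D : 𝒟) (a b c : ℕ) (hab : a < b) (hbc : b < c) (ha : rowTrace n y D a)
    (hc : rowTrace n y D c) : rowTrace n y D b := by
  by_contra hb
  obtain ⟨s, hs⟩ := rowTrace_center (n := n) D (h𝒟.1 D.1 D.2)
  have h1 := (hs y a b ha hb (by omega) (by have := hc.2.1; omega)).1 hab
  have h2 := (hs y c b hc hb (by omega) (by have := hc.2.1; omega)).2 hbc
  have : (a : ℝ) < c := by exact_mod_cast hab.trans hbc
  linarith

theorem rowTrace_cover {n : ℕ} {𝒟 : Set (Set Plane)} (h𝒟 : IsIdentifying 𝒟 (grid 2 n)) {y : ℤ}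
    (hy : 1 ≤ y) (hy' : y ≤ 2) {x : ℕ} (hx : 1 ≤ x) (hx' : x ≤ n) :
    ∃ D : 𝒟, rowTrace n y D x := by
  obtain ⟨D, hD, hmem⟩ := h𝒟.2.1 (latticePoint x y)
    (latticePoint_mem_grid hy (by simpa using hy') (by omega) (by omega))
  exact ⟨⟨D, hD⟩, hx, hx', hmem⟩

theorem rowTrace_separate {n : ℕ} {𝒟 : Set (Set Plane)} (h𝒟 : IsIdentifying 𝒟 (grid 2 n))
    {y y' : ℤ} (hy : 1 ≤ y) (hy' : y ≤ 2) (hz : 1 ≤ y') (hz' : y' ≤ 2) {x x' : ℕ} (hx : 1 ≤ x)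
    (hx' : x ≤ n) (hw : 1 ≤ x') (hw' : x' ≤ n) (hne : ¬(x = x' ∧ y = y')) :
    ∃ D : 𝒟, ¬(rowTrace n y D x ↔ rowTrace n y' D x') := by
  obtain ⟨D, hD, hsep⟩ := h𝒟.2.2 (latticePoint x y)
    (latticePoint_mem_grid hy (by simpa using hy') (by omega) (by omega)) (latticePoint x' y')
    (latticePoint_mem_grid hz (by simpa using hz') (by omega) (by omega)) (by
      intro h
      have := latticePoint_injective h
      exact hne ⟨by omega, this.2⟩)
  refine ⟨⟨D, hD⟩, ?_⟩
  unfold Separates at hsep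
  simp only [rowTrace, hx, hx', hw, hw', true_and]
  tauto

/-- Inner edges are crossed by separation. The trace is empty outside columns 1 to n, so the outer
edges are crossed by any disk covering the first or last point. -/
theorem rowTrace_cross {n : ℕ} (hn : 1 ≤ n) {𝒟 : Set (Set Plane)}
    (h𝒟 : IsIdentifying 𝒟 (grid 2 n)) {y : ℤ} (hy : 1 ≤ y) (hy' : y ≤ 2) (t : ℕ) (ht : t ≤ n) :
    ∃ D : 𝒟, ¬(rowTrace n y D t ↔ rowTrace n y D (t + 1)) := by
  rcases Nat.eq_zero_or_pos t with rfl | ht0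
  · obtain ⟨D, hD⟩ := rowTrace_cover h𝒟 hy hy' (x := 1) le_rfl hn
    exact ⟨D, fun h => by simpa [rowTrace] using h.2 hD⟩
  · rcases ht.eq_or_lt with rfl | hlt
    · obtain ⟨D, hD⟩ := rowTrace_cover h𝒟 hy hy' ht0 le_rfl
      exact ⟨D, fun h => by simpa [rowTrace] using h.1 hD⟩
    · exact rowTrace_separate h𝒟 hy hy' hy hy' ht0 ht (by omega) hlt (by omega)

theorem add_one_le_two_mul_card {n : ℕ} (hn : 1 ≤ n) {𝒟 : Set (Set Plane)} [Fintype 𝒟]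
    (h𝒟 : IsIdentifying 𝒟 (grid 2 n)) : n + 1 ≤ 2 * Fintype.card 𝒟 :=
  row_crossing_bound (rowTrace_convex h𝒟 1) (rowTrace_cross hn h𝒟 le_rfl one_le_two)

/-- The codes of the points are distinct and nonempty; `none` stands for the unused empty code. -/
theorem two_mul_add_one_le_two_pow_card {n : ℕ} {𝒟 : Set (Set Plane)} [Fintype 𝒟]
    (h𝒟 : IsIdentifying 𝒟 (grid 2 n)) : 2 * n + 1 ≤ 2 ^ Fintype.card 𝒟 := by
  classical
  let row : Bool → ℤ := fun b => if b then 1 else 2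
  have hrow : ∀ b, 1 ≤ row b ∧ row b ≤ 2 := by decide
  let code : Option (Fin n × Bool) → Set 𝒟 := fun p =>
    p.elim ∅ fun q => {D | rowTrace n (row q.2) D (q.1 + 1)}
  have hinj : Function.Injective code := by
    have hcov : ∀ q, code (some q) ≠ ∅ := by
      intro q h
      obtain ⟨D, hD⟩ := rowTrace_cover h𝒟 (hrow q.2).1 (hrow q.2).2 (x := q.1 + 1)
        (by omega) (by omega)
      have : D ∈ code (some q) := hD
      simp [h] at this
    rintro (_ | p) (_ | q) h
    · rfl
    · exact absurd h.symm (hcov q)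
    · exact absurd h (hcov p)
    · by_contra hne
      obtain ⟨D, hD⟩ := rowTrace_separate h𝒟 (hrow p.2).1 (hrow p.2).2 (hrow q.2).1 (hrow q.2).2
        (x := p.1 + 1) (x' := q.1 + 1) (by omega) (by omega) (by omega) (by omega) (by
          rintro ⟨h1, h2⟩
          apply hne
          have h3 : p.2 = q.2 := by
            revert h2
            generalize p.2 = b
            generalize q.2 = c
            revert b c
            decide
          rw [Prod.ext (Fin.ext (by omega)) h3])
      exact hD (Set.ext_iff.1 h D)
  have := Fintype.card_le_of_injective code hinj
  rw [Fintype.card_option, Fintype.card_prod, Fintype.card_fin, Fintype.card_bool,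
    Fintype.card_set] at this
  omega

/-! ### Four disks do not suffice for seven columns -/

/-- All interval ends in a row are distinct, so each corner lies in a single disk. Separating the
corners makes these four disks distinct, hence they are the whole family, and the finite check
applies. -/
theorem no_four_intervals_of_seven_columns {ι : Type*} [Fintype ι] (hcard : Fintype.card ι = 4)
    {l₁ r₁ l₂ r₂ : ι → ℕ}
    (lt₁ : ∀ i, l₁ i < r₁ i) (le₁ : ∀ i, r₁ i ≤ 7) (ll₁ : ∀ i j, l₁ i = l₁ j → i = j)
    (rr₁ : ∀ i j, r₁ i = r₁ j → i = j) (lr₁ : ∀ i j, l₁ i ≠ r₁ j)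
    (lt₂ : ∀ i, l₂ i < r₂ i) (le₂ : ∀ i, r₂ i ≤ 7) (ll₂ : ∀ i j, l₂ i = l₂ j → i = j)
    (rr₂ : ∀ i j, r₂ i = r₂ j → i = j) (lr₂ : ∀ i j, l₂ i ≠ r₂ j)
    (mid₁ : ∀ i, 1 ≤ l₁ i → r₂ i ≤ 6 → l₁ i + r₁ i ≤ l₂ i + r₂ i + 1)
    (mid₂ : ∀ i, 1 ≤ l₂ i → r₁ i ≤ 6 → l₂ i + r₂ i ≤ l₁ i + r₁ i + 1)
    (cov₁ : ∀ x, 1 ≤ x → x ≤ 7 → ∃ i, l₁ i < x ∧ x ≤ r₁ i)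
    (cov₂ : ∀ x, 1 ≤ x → x ≤ 7 → ∃ i, l₂ i < x ∧ x ≤ r₂ i)
    (sep₁ : ∀ x y, 1 ≤ x → x ≤ 7 → 1 ≤ y → y ≤ 7 → x ≠ y →
      ∃ i, ¬((l₁ i < x ∧ x ≤ r₁ i) ↔ (l₁ i < y ∧ y ≤ r₁ i)))
    (sep₂ : ∀ x y, 1 ≤ x → x ≤ 7 → 1 ≤ y → y ≤ 7 → x ≠ y →
      ∃ i, ¬((l₂ i < x ∧ x ≤ r₂ i) ↔ (l₂ i < y ∧ y ≤ r₂ i)))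
    (sep : ∀ x y, 1 ≤ x → x ≤ 7 → 1 ≤ y → y ≤ 7 →
      ∃ i, ¬((l₁ i < x ∧ x ≤ r₁ i) ↔ (l₂ i < y ∧ y ≤ r₂ i))) : False := by
  obtain ⟨i, hi, -⟩ := cov₁ 1 le_rfl (by omega)
  obtain ⟨j, hj, -⟩ := cov₂ 1 le_rfl (by omega)
  obtain ⟨k, -, hk⟩ := cov₁ 7 (by omega) le_rfl
  obtain ⟨l, -, hl⟩ := cov₂ 7 (by omega) le_rfl
  replace hi : l₁ i = 0 := by omega
  replace hj : l₂ j = 0 := by omega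
  replace hk : r₁ k = 7 := le_antisymm (le₁ k) hk
  replace hl : r₂ l = 7 := le_antisymm (le₂ l) hl
  have ci : ∀ u, u = i ∨ 1 ≤ l₁ u := fun u => by
    by_cases h : l₁ u = l₁ i
    · exact Or.inl (ll₁ _ _ h)
    · omega
  have cj : ∀ u, u = j ∨ 1 ≤ l₂ u := fun u => by
    by_cases h : l₂ u = l₂ j
    · exact Or.inl (ll₂ _ _ h)
    · omega
  have ck : ∀ u, u = k ∨ r₁ u ≤ 6 := fun u => by
    by_cases h : r₁ u = r₁ k
    · exact Or.inl (rr₁ _ _ h)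
    · have := le₁ u
      omega
  have cl : ∀ u, u = l ∨ r₂ u ≤ 6 := fun u => by
    by_cases h : r₂ u = r₂ l
    · exact Or.inl (rr₂ _ _ h)
    · have := le₂ u
      omega
  -- If one disk held two corners, both would have that disk alone as code.
  have hij : i ≠ j := by
    rintro rfl
    obtain ⟨u, hu⟩ := sep 1 1 le_rfl (by omega) le_rfl (by omega)
    have := lt₁ u; have := lt₂ u
    rcases ci u with rfl | h <;> rcases cj u with h' | h' <;> first | omega | (subst h'; omega)
  have hik : i ≠ k := by
    rintro rfl
    obtain ⟨u, hu⟩ := sep₁ 1 7 le_rfl (by omega) (by omega) le_rfl (by omega)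
    have := lt₁ u; have := lt₂ u
    rcases ci u with rfl | h <;> rcases ck u with h' | h' <;> first | omega | (subst h'; omega)
  have hil : i ≠ l := by
    rintro rfl
    obtain ⟨u, hu⟩ := sep 1 7 le_rfl (by omega) (by omega) le_rfl
    have := lt₁ u; have := lt₂ u
    rcases ci u with rfl | h <;> rcases cl u with h' | h' <;> first | omega | (subst h'; omega)
  have hjk : j ≠ k := by
    rintro rfl
    obtain ⟨u, hu⟩ := sep 7 1 (by omega) le_rfl le_rfl (by omega)
    have := lt₁ u; have := lt₂ u
    rcases cj u with rfl | h <;> rcases ck u with h' | h' <;> first | omega | (subst h'; omega)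
  have hjl : j ≠ l := by
    rintro rfl
    obtain ⟨u, hu⟩ := sep₂ 1 7 le_rfl (by omega) (by omega) le_rfl (by omega)
    have := lt₁ u; have := lt₂ u
    rcases cj u with rfl | h <;> rcases cl u with h' | h' <;> first | omega | (subst h'; omega)
  have hkl : k ≠ l := by
    rintro rfl
    obtain ⟨u, hu⟩ := sep 7 7 (by omega) le_rfl (by omega) le_rfl
    have := lt₁ u; have := lt₂ u
    rcases ck u with rfl | h <;> rcases cl u with h' | h' <;> first | omega | (subst h'; omega)
  have huniv : ∀ u, u = i ∨ u = j ∨ u = k ∨ u = l := by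
    classical
    have : ({i, j, k, l} : Finset ι) = Finset.univ := by
      rw [← Finset.card_eq_iff_eq_univ, hcard]
      simp [hij, hik, hil, hjk, hjl, hkl]
    intro u
    simpa [← this] using Finset.mem_univ u
  have hm : ∀ x, 1 ≤ x → x ≤ 6 → x ∈ List.range' 1 6 := fun x h h' =>
    List.mem_range'_1.2 ⟨h, by omega⟩
  have bi := (ci i).resolve_right (by omega)
  have l1j := (ci j).resolve_left hij.symm
  have l1k := (ci k).resolve_left hik.symm
  have l1l := (ci l).resolve_left hil.symm
  have l2i := (cj i).resolve_left hij
  have l2k := (cj k).resolve_left hjk.symm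
  have l2l := (cj l).resolve_left hjl.symm
  have r1i := (ck i).resolve_left hik
  have r1j := (ck j).resolve_left hjk
  have r1l := (ck l).resolve_left hkl.symm
  have r2i := (cl i).resolve_left hil
  have r2j := (cl j).resolve_left hjl
  have r2k := (cl k).resolve_left hkl
  have t1i := lt₁ i
  have t1j := lt₁ j
  have t1k := lt₁ k
  have t1l := lt₁ l
  have t2i := lt₂ i
  have t2j := lt₂ j
  have t2k := lt₂ k
  have t2l := lt₂ l
  have mi := mid₂ i l2i r1i
  have mj := mid₁ j l1j r2j
  have mk := mid₁ k l1k r2k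
  have ml := mid₂ l l2l r1l
  have L₁ : ∀ {a b}, a ≠ b → l₁ a ≠ l₁ b := fun h h' => h (ll₁ _ _ h')
  have R₁ : ∀ {a b}, a ≠ b → r₁ a ≠ r₁ b := fun h h' => h (rr₁ _ _ h')
  have L₂ : ∀ {a b}, a ≠ b → l₂ a ≠ l₂ b := fun h h' => h (ll₂ _ _ h')
  have R₂ : ∀ {a b}, a ≠ b → r₂ a ≠ r₂ b := fun h h' => h (rr₂ _ _ h')
  have lk6 : l₁ k ≤ 6 := by omega
  have ll6 : l₂ l ≤ 6 := by omega
  obtain ⟨x, hx, y, hy, hxy⟩ := exists_equal_codes_of_seven_columns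
    (r₁ i) (hm _ (by omega) r1i) (l₁ k) (hm _ l1k lk6) (lr₁ k i).symm
    (l₁ j) (hm _ l1j (by omega)) (lr₁ j i) (L₁ hjk)
    (r₁ j) (hm _ (by omega) r1j) t1j (R₁ hij.symm) (lr₁ k j).symm
    (l₁ l) (hm _ l1l (by omega)) (lr₁ l i) (L₁ hkl.symm) (L₁ hjl.symm) (lr₁ l j)
    (r₁ l) (hm _ (by omega) r1l) t1l (R₁ hil.symm) (lr₁ k l).symm (lr₁ j l).symm (R₁ hjl.symm)
    (by
      intro x hx y hy hlt hxy
      rw [List.mem_range'_1] at hx hy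
      obtain ⟨u, hu⟩ := sep₁ x y (by omega) (by omega) (by omega) (by omega) (by omega)
      rcases huniv u with rfl | rfl | rfl | rfl <;> omega)
    (r₂ j) (hm _ (by omega) r2j) (by omega)
    (l₂ l) (hm _ l2l ll6) (lr₂ l j) (by omega)
    (l₂ i) (hm _ l2i (by omega)) (lr₂ i j) (L₂ hil)
    (r₂ i) (hm _ (by omega) r2i) t2i (R₂ hij) (lr₂ l i).symm (by omega)
    (l₂ k) (hm _ l2k (by omega)) (lr₂ k j) (L₂ hkl) (L₂ hik.symm) (lr₂ k i)
    (r₂ k) (hm _ (by omega) r2k) t2k (R₂ hjk.symm) (lr₂ l k).symm (lr₂ i k).symm (R₂ hik.symm)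
    (by omega)
  rw [List.mem_range'_1] at hx hy
  rcases hxy with hxy | hxy
  · obtain ⟨u, hu⟩ := sep x y (by omega) (by omega) (by omega) (by omega)
    rcases huniv u with rfl | rfl | rfl | rfl <;> omega
  · obtain ⟨u, hu⟩ := sep₂ x y (by omega) (by omega) (by omega) (by omega) hxy.1
    rcases huniv u with rfl | rfl | rfl | rfl <;> omega

theorem card_ne_four_of_seven_columns {𝒟 : Set (Set Plane)} [Fintype 𝒟]
    (h𝒟 : IsIdentifying 𝒟 (grid 2 7)) : Fintype.card 𝒟 ≠ 4 := by
  intro hcard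
  obtain ⟨l₁, r₁, lt₁, le₁, ll₁, rr₁, lr₁, hM₁⟩ := exists_intervals_of_tight_row
    (rowTrace_convex h𝒟 1) (rowTrace_cross (by omega) h𝒟 le_rfl one_le_two) (by omega)
  obtain ⟨l₂, r₂, lt₂, le₂, ll₂, rr₂, lr₂, hM₂⟩ := exists_intervals_of_tight_row
    (rowTrace_convex h𝒟 2) (rowTrace_cross (by omega) h𝒟 one_le_two le_rfl) (by omega)
  -- Columns `l i` in row `y` and `r' i + 1` in row `z` bound the disk's centre from either side.
  -- Both must lie in the grid, since the trace says nothing beyond it.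
  have mid : ∀ (y z : ℤ) (l r l' r' : 𝒟 → ℕ), (∀ i, l i < r i) → (∀ i, l' i < r' i) →
      (∀ i x, rowTrace 7 y i x ↔ l i < x ∧ x ≤ r i) →
      (∀ i x, rowTrace 7 z i x ↔ l' i < x ∧ x ≤ r' i) →
      ∀ i, 1 ≤ l i → r' i ≤ 6 → l i + r i ≤ l' i + r' i + 1 := by
    intro y z l r l' r' hlt hlt' hM hM' i hl hr
    obtain ⟨s, hs⟩ := rowTrace_center (n := 7) i (h𝒟.1 i.1 i.2)
    have hr7 : r i ≤ 7 := ((hM i (r i)).2 ⟨hlt i, le_rfl⟩).2.1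
    have h1 := (hs y (r i) (l i) ((hM _ _).2 ⟨hlt i, le_rfl⟩) (fun h => by
      have := (hM _ _).1 h; omega) hl (by have := hlt i; omega)).2 (hlt i)
    have h2 := (hs z (l' i + 1) (r' i + 1) ((hM' _ _).2 ⟨by omega, hlt' i⟩) (fun h => by
      have := (hM' _ _).1 h; omega) (by omega) (by omega)).1 (by have := hlt' i; omega)
    have h3 := h1.trans h2
    have h4 : r i + l i < l' i + 1 + (r' i + 1) := by exact_mod_cast h3
    omega
  refine no_four_intervals_of_seven_columns hcard lt₁ le₁ ll₁ rr₁ lr₁ lt₂ le₂ ll₂ rr₂ lr₂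
    (mid 1 2 _ _ _ _ lt₁ lt₂ hM₁ hM₂) (mid 2 1 _ _ _ _ lt₂ lt₁ hM₂ hM₁) ?_ ?_ ?_ ?_ ?_
  · intro x h1 h2
    simpa only [hM₁] using rowTrace_cover h𝒟 le_rfl one_le_two h1 h2
  · intro x h1 h2
    simpa only [hM₂] using rowTrace_cover h𝒟 one_le_two le_rfl h1 h2
  · intro x y h1 h2 h3 h4 h
    simpa only [hM₁] using rowTrace_separate h𝒟 le_rfl one_le_two le_rfl one_le_two h1 h2 h3 h4
      (fun h' => h h'.1)
  · intro x y h1 h2 h3 h4 h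
    simpa only [hM₂] using rowTrace_separate h𝒟 one_le_two le_rfl one_le_two le_rfl h1 h2 h3 h4
      (fun h' => h h'.1)
  · intro x y h1 h2 h3 h4
    simpa only [hM₁, hM₂] using rowTrace_separate h𝒟 le_rfl one_le_two one_le_two le_rfl h1 h2 h3
      h4 (by norm_num)

/-! ### The theorem -/

/-- A lower bound for the cardinality of finite identifying families is a lower bound for
`diskIdNumber`. -/
theorem le_diskIdNumber {S : Set Plane} {N : ℕ}
    (h : ∀ (𝒟 : Set (Set Plane)) [Fintype 𝒟], IsIdentifying 𝒟 S → N ≤ Fintype.card 𝒟) :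
    (N : ℕ∞) ≤ diskIdNumber S := by
  refine le_iInf₂ fun 𝒟 h𝒟 => ?_
  rcases 𝒟.finite_or_infinite with hfin | hinf
  · have := hfin.fintype
    rw [← Set.coe_fintypeCard]
    exact_mod_cast h 𝒟 h𝒟
  · simp [hinf.encard_eq]

theorem natCeil_add_one_div_two (n : ℕ) : ⌈((n : ℚ) + 1) / 2⌉₊ = n / 2 + 1 := by
  rw [Nat.ceil_eq_iff (by omega)]
  have h : n = 2 * (n / 2) ∨ n = 2 * (n / 2) + 1 := by omega
  generalize n / 2 = m at *
  push_cast
  rcases h with rfl | rfl <;> push_cast <;> constructor <;> linarith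

theorem mainTheorem7 (n : ℕ) (hn : 2 ≤ n) :
    diskIdNumber (grid 2 n) =
      if n ∈ ({2, 3, 4, 5, 7} : Finset ℕ) then
        ((⌈((n : ℚ) + 1) / 2⌉₊ + 1 : ℕ) : ℕ∞)
      else
        ((⌈((n : ℚ) + 1) / 2⌉₊ : ℕ) : ℕ∞) := by
  rw [natCeil_add_one_div_two]
  have small : ∀ m k : ℕ, 2 ^ k < 2 * m + 1 → ((k + 1 : ℕ) : ℕ∞) ≤ diskIdNumber (grid 2 m) := by
    intro m k hk
    refine le_diskIdNumber fun 𝒟 _ h𝒟 => ?_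
    by_contra hlt
    have h1 := two_mul_add_one_le_two_pow_card h𝒟
    have h2 : 2 ^ Fintype.card 𝒟 ≤ 2 ^ k := Nat.pow_le_pow_right two_pos (by omega)
    omega
  split_ifs with h
  · simp only [Finset.mem_insert, Finset.mem_singleton] at h
    rcases h with rfl | rfl | rfl | rfl | rfl
    · exact le_antisymm ((diskIdNumber_mono (grid_mono 2 (by omega))).trans
        diskIdNumber_grid_two_three_le) (small 2 2 (by norm_num))
    · exact le_antisymm diskIdNumber_grid_two_three_le (small 3 2 (by norm_num))
    · exact le_antisymm ((diskIdNumber_mono (grid_mono 2 (by omega))).trans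
        diskIdNumber_grid_two_six_le) (small 4 3 (by norm_num))
    · exact le_antisymm ((diskIdNumber_mono (grid_mono 2 (by omega))).trans
        diskIdNumber_grid_two_six_le) (small 5 3 (by norm_num))
    · refine le_antisymm ((diskIdNumber_mono (grid_mono 2 (by omega))).trans
        (diskIdNumber_grid_two_odd_le 0)) (le_diskIdNumber fun 𝒟 _ h𝒟 => ?_)
      have h1 := add_one_le_two_mul_card (by omega) h𝒟
      have h2 := card_ne_four_of_seven_columns h𝒟
      omega
  · simp only [Finset.mem_insert, Finset.mem_singleton, not_or] at h
    apply le_antisymm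
    · rcases Nat.lt_or_ge n 8 with h8 | h8
      · obtain rfl : n = 6 := by omega
        exact diskIdNumber_grid_two_six_le
      · refine (diskIdNumber_mono (grid_mono 2 (n' := 2 * (n / 2 - 4) + 9) (by omega))).trans
          ((diskIdNumber_grid_two_odd_le _).trans ?_)
        exact_mod_cast (by omega : n / 2 - 4 + 5 ≤ n / 2 + 1)
    · refine le_diskIdNumber fun 𝒟 _ h𝒟 => ?_
      have h1 := add_one_le_two_mul_card (by omega) h𝒟
      omega
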